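/- Let $n,m\ge 1$ be integers and let $S^1=\mathbb R/\mathbb Z$. A multifunction $f\colon S^1\multimap S^1$ is an $n$-valued map if every $f(x)$ has exactly $n$ elements and $f$ is continuous (both upper and lower semicontinuous); homotopies of $n$-valued maps are $n$-valued maps $S^1\times[0,1]\multimap S^1$. A pair $(f,g)$ is $(n,m)$-valued if $f$ is an $n$-valued map and $g$ is an $m$-valued map, and two such pairs are homotopic if their components are homotopic through $n$-valued and $m$-valued maps respectively. The degree of an $n$-valued map $f\colon S^1\multimap S^1$ is defined as follows: write $f(t \bmod 1)=\{\tilde f_0(t),\dots,\tilde f_{n-1}(t)\} \bmod 1$ for $t\in[0,1]$, with $\tilde f_j\colon[0,1]\to\mathbb R$ continuous and $0\le \tilde f_0(0)<\dots<\tilde f_{n-1}(0)<1$; if $\tilde f_0(1)=v+\tilde f_J(0)$ with $v\in\mathbb Z$ and $0\le J\le n-1$, then $\deg f=nv+J$. For $d\in\mathbb Z$ the $n$-valued power map of degree $d$ is $$\phi_{n,d}(t \bmod 1)=\Big\{\tfrac dn t+\tfrac un \bmod 1:\ u=0,\dots,n-1\Big\}.$$ Put $\mathrm{Coin}_{X\times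 Y}(f:g)=\{(x,y)\in S^1\times S^1:\ y\in f(x)\cap g(x)\}$ (here $X=Y=S^1$), and let $\mathrm{MC}_{X\times Y}(f:g)$ be the minimal cardinality of $\mathrm{Coin}_{X\times Y}(f':g')$ over all $(n,m)$-valued pairs $(f',g')$ homotopic to $(f,g)$. Let $(f,g)$ be an $(n,m)$-valued pair of self-maps of $S^1$ with degrees $a$ and $b$ respectively. Then $$\mathrm{MC}_{X\times Y}(f:g)=|am-bn|,$$ and $(\phi_{n,a},\phi_{m,b})$ is an $(n,m)$-valued pair homotopic to $(f,g)$. If moreover $am\ne bn$, then the minimum is attained by this pair of power maps: $$\mathrm{MC}_{X\times Y}(f:g)=\#\mathrm{Coin}_{X\times Y}(\phi_{n,a}:\phi_{m,b})=|am-bn|.$$ -/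

import Mathlib

namespace NValued

open unitInterval

/-- An `n`-valued map `f : X ⊸ Y`: every value is a set with exactly `n` elements, and the
multifunction is continuous, i.e. upper and lower semicontinuous (`{x | f x ⊆ U}` and
`{x | f x ∩ U ≠ ∅}` are open for every open `U`). -/
structure IsNValuedMap {X Y : Type*} [TopologicalSpace X] [TopologicalSpace Y]
    (n : ℕ) (f : X → Set Y) : Prop where
  encard_eq : ∀ x, (f x).encard = n
  upper : UpperHemicontinuous f
  lower : LowerHemicontinuous f

/-- `f` and `f'` are homotopic through an `n`-valued homotopy `X × [0,1] ⊸ Y`. -/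
def NHomotopic {X Y : Type*} [TopologicalSpace X] [TopologicalSpace Y]
    (n : ℕ) (f f' : X → Set Y) : Prop :=
  ∃ H : X × I → Set Y, IsNValuedMap n H ∧ (∀ x, H (x, 0) = f x) ∧ (∀ x, H (x, 1) = f' x)

/-- Homotopy of `(n,m)`-valued pairs of maps. -/
def PairHomotopic {X Y : Type*} [TopologicalSpace X] [TopologicalSpace Y]
    (n m : ℕ) (f g f' g' : X → Set Y) : Prop :=
  NHomotopic n f f' ∧ NHomotopic m g g'

/-- The graph intersection set `Coin_{X × Y}(f : g)`. -/
def graphCoin {X Y : Type*} (f g : X → Set Y) : Set (X × Y) :=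
  {p | p.2 ∈ f p.1 ∩ g p.1}

/-- The minimum number of graph intersections `MC_{X × Y}(f : g)`: the least cardinality of
`Coin_{X × Y}(f' : g')` over the `(n,m)`-valued pairs `(f', g')` homotopic to `(f, g)`.
(A nonempty set of elements of `ℕ∞` contains its infimum.) -/
noncomputable def minGraphCoin {X Y : Type*} [TopologicalSpace X] [TopologicalSpace Y]
    (n m : ℕ) (f g : X → Set Y) : ℕ∞ :=
  sInf {c | ∃ f' g' : X → Set Y, IsNValuedMap n f' ∧ IsNValuedMap m g' ∧
    PairHomotopic n m f g f' g' ∧ c = (graphCoin f' g').encard}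

/-- `d` is the degree of the `n`-valued self-map `f` of the circle `ℝ/ℤ`, whose covering map
`r : ℝ → ℝ/ℤ` is the coercion. The maps `F 0, …, F (n-1) : [0,1] → ℝ` are lifts of a
splitting of `f ∘ r`, with starting points `0 ≤ t_0 < ⋯ < t_{n-1} < 1`; if
`F 0` ends at `v + t_J`, then the degree is `n v + J`. -/
def HasDegree (n : ℕ) (f : UnitAddCircle → Set UnitAddCircle) (d : ℤ) : Prop :=
  ∃ (hn : 0 < n) (F : Fin n → C(I, ℝ)),
    (∀ t : I, f (((t : ℝ) : UnitAddCircle)) =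
      Set.range fun j => ((F j t : ℝ) : UnitAddCircle)) ∧
    (∀ j, F j 0 ∈ Set.Ico (0 : ℝ) 1) ∧
    (StrictMono fun j => F j 0) ∧
    ∃ (v : ℤ) (J : Fin n), F ⟨0, hn⟩ 1 = (v : ℝ) + F J 0 ∧ d = (n : ℤ) * v + (J : ℕ)

open Classical in
/-- The degree of an `n`-valued self-map of the circle (`n ≥ 1`). -/
noncomputable def degree (n : ℕ) (f : UnitAddCircle → Set UnitAddCircle) : ℤ :=
  if h : ∃ d, HasDegree n f d then h.choose else 0

/-- The `n`-valued power map of degree `d`, sending `r(t)` to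
`{r(d/n t + u/n) | u = 0, …, n-1}`; see `powerMap_coe`. -/
def powerMap (n : ℕ) (d : ℤ) (x : UnitAddCircle) : Set UnitAddCircle :=
  {y | ∃ t : ℝ, (t : UnitAddCircle) = x ∧
    ∃ u : Fin n, y = (((d : ℝ) / n * t + (u : ℕ) / n : ℝ) : UnitAddCircle)}

/-- The value of the power map does not depend on the choice of the representative `t`. -/
theorem powerMap_coe (n : ℕ) (d : ℤ) (t : ℝ) :
    powerMap n d (t : UnitAddCircle) =
      Set.range fun u : Fin n =>
        (((d : ℝ) / n * t + (u : ℕ) / n : ℝ) : UnitAddCircle) := by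
  ext y
  constructor
  · rintro ⟨s, hs, u, rfl⟩
    have hn : 0 < n := u.pos
    have hn' : (n : ℝ) ≠ 0 := by positivity
    have hnz : (n : ℤ) ≠ 0 := by positivity
    have h0 : ((s - t : ℝ) : UnitAddCircle) = 0 := by
      rw [AddCircle.coe_sub, hs, sub_self]
    obtain ⟨k, hk⟩ := (AddCircle.coe_eq_zero_iff (1 : ℝ)).1 h0
    have hst : s = t + k := by
      simp only [zsmul_eq_mul, mul_one] at hk
      linarith
    have hw0 := Int.emod_nonneg (d * k + (u : ℕ)) hnz
    have hwn := Int.emod_lt_of_pos (d * k + (u : ℕ)) (Int.natCast_pos.2 hn)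
    have hdiv := Int.emod_add_mul_ediv (d * k + (u : ℕ)) n
    set w := (d * k + (u : ℕ)) % n with hwdef
    set q := (d * k + (u : ℕ)) / (n : ℤ) with hqdef
    refine ⟨⟨w.toNat, by omega⟩, ?_⟩
    have hwR : ((w.toNat : ℕ) : ℝ) = (w : ℝ) := by exact_mod_cast Int.toNat_of_nonneg hw0
    have hdivR : (w : ℝ) + n * q = d * k + (u : ℕ) := by exact_mod_cast hdiv
    rw [← sub_eq_zero, ← AddCircle.coe_sub, AddCircle.coe_eq_zero_iff]
    refine ⟨-q, ?_⟩
    simp only [hwR, hst, zsmul_eq_mul, mul_one]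
    push_cast
    field_simp
    linarith
  · rintro ⟨u, rfl⟩
    exact ⟨t, rfl, u, rfl⟩

end NValued

/-! Over `ℝ`, an `n`-valued map unfolds into an increasing family of continuous functions `F k`, `k
: ℤ`, with `F (k + n) = F k + 1` and `F k (t + 1) = F (k + d) t`. The shift `d` is the degree
(`IsLift.degree_eq`) and is preserved by homotopy. Conversely, two families with the same `n` and
`d` are joined by the straight-line homotopy, so the degree classifies `n`-valued maps and the power
maps represent every class.

For a pair with lifts `F`, `G`, a coincidence is a solution of `F k t = G l t`. Deck transformations
change `(k, l)` by the lattice spanned by `(n, m)` and `(a, b)`, so the class of `(k, l)` modulo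
this lattice depends only on the coincidence point. If `am ≠ bn`, the intermediate value theorem
gives a solution for every `(k, l)`, hence at least as many coincidences as the index `|am - bn|` of
the lattice. For power maps the lifts are lines of distinct slopes, so each class occurs exactly
once. If `am = bn`, a small translation makes the lines disjoint. -/

namespace NValued

open Filter Topology unitInterval

/-! ### Increasing enumerations of finite subsets of the circle -/

/-- `a : ℤ → ℝ` enumerates increasingly the preimage in `ℝ` of a subset `S` of the circle
with `n` elements. -/
structure IsEnum (n : ℕ) (S : Set UnitAddCircle) (a : ℤ → ℝ) : Prop where
  strictMono : StrictMono a
  add_period : ∀ k, a (k + n) = a k + 1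
  coe_mem_iff : ∀ y : ℝ, (y : UnitAddCircle) ∈ S ↔ ∃ k, a k = y

theorem coe_eq_coe_iff {x y : ℝ} :
    (x : UnitAddCircle) = (y : UnitAddCircle) ↔ ∃ q : ℤ, y = x + q := by
  rw [eq_comm, ← sub_eq_zero, ← AddCircle.coe_sub, AddCircle.coe_eq_zero_iff]
  simp only [zsmul_eq_mul, mul_one]
  exact exists_congr fun q => ⟨fun h => by linarith, fun h => by linarith⟩

theorem add_mul_of_add_period {n : ℕ} {a : ℤ → ℝ} (h : ∀ k, a (k + n) = a k + 1) (k q : ℤ) :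
    a (k + n * q) = a k + q := by
  induction q using Int.induction_on with
  | zero => simp
  | succ i ih =>
    rw [show k + n * ((i : ℤ) + 1) = (k + n * i) + n by ring, h, ih]
    push_cast; ring
  | pred i ih =>
    have := h (k + n * (-(i : ℤ) - 1))
    rw [show k + n * (-(i : ℤ) - 1) + n = k + n * (-(i : ℤ)) by ring, ih] at this
    push_cast at this ⊢
    linarith

theorem eq_emod_add_ediv {n : ℕ} {a : ℤ → ℝ} (h : ∀ k, a (k + n) = a k + 1) (k : ℤ) :
    a k = a (k % n) + (k / n : ℤ) := by
  rw [← add_mul_of_add_period h, Int.emod_add_mul_ediv]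

namespace IsEnum

variable {n : ℕ} {S : Set UnitAddCircle} {a b : ℤ → ℝ}

theorem of_strictMono (ha : StrictMono a) (hp : ∀ k, a (k + n) = a k + 1) :
    IsEnum n (Set.range fun k => (a k : UnitAddCircle)) a where
  strictMono := ha
  add_period := hp
  coe_mem_iff y := by
    constructor
    · rintro ⟨k, hk⟩
      obtain ⟨q, hq⟩ := coe_eq_coe_iff.1 hk
      exact ⟨k + n * q, by rw [add_mul_of_add_period hp, hq]⟩
    · rintro ⟨k, rfl⟩
      exact ⟨k, rfl⟩

theorem add_mul (h : IsEnum n S a) (k q : ℤ) : a (k + n * q) = a k + q :=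
  add_mul_of_add_period h.add_period k q

theorem coe_mem (h : IsEnum n S a) (k : ℤ) : (a k : UnitAddCircle) ∈ S :=
  (h.coe_mem_iff _).2 ⟨k, rfl⟩

theorem eq_range (h : IsEnum n S a) : S = Set.range fun k => (a k : UnitAddCircle) := by
  ext y
  constructor
  · intro hy
    obtain ⟨t, rfl⟩ := QuotientAddGroup.mk_surjective y
    obtain ⟨k, hk⟩ := (h.coe_mem_iff t).1 hy
    exact ⟨k, congrArg _ hk⟩
  · rintro ⟨k, rfl⟩
    exact h.coe_mem k

theorem pos (h : IsEnum n S a) : 0 < n := by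
  rcases Nat.eq_zero_or_pos n with rfl | hn
  · have := h.add_period 0
    simp at this
  · exact hn

theorem coe_eq_iff (h : IsEnum n S a) {k l : ℤ} :
    (a k : UnitAddCircle) = (a l : UnitAddCircle) ↔ ∃ q, l = k + n * q := by
  rw [coe_eq_coe_iff]
  refine exists_congr fun q => ?_
  rw [← h.add_mul, h.strictMono.injective.eq_iff]

theorem injOn (h : IsEnum n S a) :
    Set.InjOn (fun i : ℕ => (a i : UnitAddCircle)) (Finset.range n : Set ℕ) := by
  intro i hi j hj hij
  obtain ⟨q, hq⟩ := h.coe_eq_iff.1 hij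
  simp only [Finset.coe_range, Set.mem_Iio] at hi hj
  have hn : (0 : ℤ) < n := by omega
  have h1 : (j : ℤ) % n = i % n := by rw [hq]; simp
  rw [Int.emod_eq_of_lt (by omega) (by omega), Int.emod_eq_of_lt (by omega) (by omega)] at h1
  omega

theorem eq_image (h : IsEnum n S a) :
    S = (fun i : ℕ => (a i : UnitAddCircle)) '' (Finset.range n : Set ℕ) := by
  rw [h.eq_range]
  have hn : (0 : ℤ) < n := by exact_mod_cast h.pos
  ext y
  constructor
  · rintro ⟨k, rfl⟩
    have h0 := Int.emod_nonneg k hn.ne'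
    have h1 := Int.emod_lt_of_pos k hn
    refine ⟨(k % n).toNat, by simp; omega, ?_⟩
    refine h.coe_eq_iff.2 ⟨k / n, ?_⟩
    rw [Int.toNat_of_nonneg h0, Int.emod_add_mul_ediv]
  · rintro ⟨i, -, rfl⟩
    exact ⟨i, rfl⟩

theorem encard_eq (h : IsEnum n S a) : S.encard = n := by
  rw [h.eq_image, h.injOn.encard_image, Set.encard_coe_eq_coe_finsetCard, Finset.card_range]

theorem of_mem (ha : StrictMono a) (hp : ∀ k, a (k + n) = a k + 1)
    (hm : ∀ k, (a k : UnitAddCircle) ∈ S) (hS : S.encard = n) : IsEnum n S a := by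
  have h := of_strictMono ha hp
  convert h using 1
  symm
  refine (Set.finite_of_encard_eq_coe h.encard_eq).eq_of_subset_of_encard_le ?_ ?_
  · rintro _ ⟨k, rfl⟩
    exact hm k
  · rw [h.encard_eq, hS]

theorem finsum_mem (h : IsEnum n S a) :
    ∑ᶠ y ∈ S, y = ((∑ i ∈ Finset.range n, a i : ℝ) : UnitAddCircle) := by
  rw [h.eq_image, finsum_mem_image h.injOn, finsum_mem_coe_finset]
  exact (map_sum (QuotientAddGroup.mk' (AddSubgroup.zmultiples (1 : ℝ))) _ _).symm

theorem shift (h : IsEnum n S a) (c : ℤ) : IsEnum n S fun k => a (k + c) where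
  strictMono := fun k l hkl => h.strictMono (by omega)
  add_period k := by rw [add_right_comm, h.add_period]
  coe_mem_iff y := by
    rw [h.coe_mem_iff]
    exact ⟨fun ⟨k, hk⟩ => ⟨k - c, by simpa using hk⟩, fun ⟨k, hk⟩ => ⟨_, hk⟩⟩

/-- Advancing the index by one replaces `a 0` by `a n = a 0 + 1`. Thus the sum over one period tells
apart the enumerations of one set. -/
theorem sum_shift (hp : ∀ k, a (k + n) = a k + 1) (c : ℤ) :
    ∑ i ∈ Finset.range n, a (i + c) = ∑ i ∈ Finset.range n, a i + c := by
  have step : ∀ c : ℤ, ∑ i ∈ Finset.range n, a (i + (c + 1)) =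
      ∑ i ∈ Finset.range n, a (i + c) + 1 := by
    intro c
    have h1 := Finset.sum_range_succ (fun i : ℕ => a (i + c)) n
    have h2 := Finset.sum_range_succ' (fun i : ℕ => a (i + c)) n
    rw [h1] at h2
    have h3 := hp c
    rw [add_comm c] at h3
    simp only [Nat.cast_add, Nat.cast_one, Nat.cast_zero, zero_add] at h2
    simp only [add_assoc, add_comm (1 : ℤ) c] at h2
    linarith
  induction c using Int.induction_on with
  | zero => simp
  | succ i ih => rw [step, ih]; push_cast; ring
  | pred i ih =>
    have := step (-(i : ℤ) - 1)
    rw [sub_add_cancel, ih] at this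
    push_cast at this ⊢
    linarith

/-- The change of index is an order automorphism of `ℤ`, hence a translation. -/
theorem exists_shift (ha : IsEnum n S a) (hb : IsEnum n S b) : ∃ c, ∀ k, b k = a (k + c) := by
  choose φ hφ using fun k => (ha.coe_mem_iff (b k)).1 (hb.coe_mem k)
  have hmono : ∀ {k l}, φ k < φ l ↔ k < l := by
    intro k l
    rw [← ha.strictMono.lt_iff_lt, hφ, hφ, hb.strictMono.lt_iff_lt]
  have hstep : ∀ k, φ (k + 1) = φ k + 1 := by
    intro k
    have h1 : φ k < φ (k + 1) := hmono.2 (by omega)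
    obtain ⟨j, hj⟩ := (hb.coe_mem_iff (a (φ k + 1))).1 (ha.coe_mem _)
    rw [← hφ j, ha.strictMono.injective.eq_iff] at hj
    have h2 : k < j := hmono.1 (by omega)
    by_contra hne
    have h3 : j < k + 1 := hmono.1 (by omega)
    omega
  have hall : ∀ k, φ k = k + φ 0 := by
    intro k
    induction k using Int.induction_on with
    | zero => simp
    | succ i ih => rw [hstep, ih]; ring
    | pred i ih =>
      have := hstep (-(i : ℤ) - 1)
      rw [sub_add_cancel] at this
      omega
  exact ⟨φ 0, fun k => by rw [← hφ, hall]⟩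

theorem eq_of_sum_eq (ha : IsEnum n S a) (hb : IsEnum n S b)
    (h : ∑ i ∈ Finset.range n, a i = ∑ i ∈ Finset.range n, b i) : a = b := by
  obtain ⟨c, hc⟩ := ha.exists_shift hb
  have h1 : ∑ i ∈ Finset.range n, b i = ∑ i ∈ Finset.range n, a i + c := by
    rw [← sum_shift ha.add_period]
    exact Finset.sum_congr rfl fun i _ => hc i
  have h2 : (c : ℝ) = 0 := by linarith
  have h3 : c = 0 := by exact_mod_cast h2
  funext k
  rw [hc, h3, add_zero]

theorem exists_gap (h : IsEnum n S a) : ∃ δ > 0, ∀ k, a k + δ ≤ a (k + 1) := by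
  have hn : (0 : ℤ) < n := by exact_mod_cast h.pos
  have hne : (Finset.range n).Nonempty := Finset.nonempty_range_iff.2 h.pos.ne'
  obtain ⟨i, -, hi⟩ := Finset.exists_min_image (Finset.range n)
    (fun i : ℕ => a (i + 1) - a i) hne
  refine ⟨a (i + 1) - a i, sub_pos.2 (h.strictMono (by omega)), fun k => ?_⟩
  have h0 := Int.emod_nonneg k hn.ne'
  have h1 := Int.emod_lt_of_pos k hn
  have h2 := hi (k % n).toNat (by simp; omega)
  rw [Int.toNat_of_nonneg h0] at h2
  have h3 := h.add_mul (k % n) (k / n)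
  have h4 := h.add_mul (k % n + 1) (k / n)
  rw [add_right_comm] at h4
  rw [Int.emod_add_mul_ediv] at h3 h4
  linarith

end IsEnum

theorem ediv_emod_succ {n : ℕ} (hn : 0 < n) (k : ℤ) :
    ((k + 1) / n = k / n ∧ (k + 1) % n = k % n + 1) ∨
    ((k + 1) / n = k / n + 1 ∧ (k + 1) % n = 0 ∧ k % n = n - 1) := by
  have hn' : (0 : ℤ) < n := by exact_mod_cast hn
  have h0 := Int.emod_nonneg k hn'.ne'
  have h1 := Int.emod_lt_of_pos k hn'
  have h2 := Int.emod_add_mul_ediv k n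
  by_cases h : k % n + 1 < n
  · left
    exact (Int.ediv_emod_unique hn').2 ⟨by linarith, by omega, h⟩
  · right
    have : k % n = n - 1 := by omega
    rw [← and_assoc]
    refine ⟨(Int.ediv_emod_unique hn').2 ⟨?_, by omega, hn'⟩, this⟩
    rw [mul_add]
    omega

/-- The values of `c` on `[0, n)` extend to `ℤ` so that `a (k + n) = a k + 1`. -/
theorem exists_periodic_extension {n : ℕ} (hn : 0 < n) (c : ℤ → ℝ) :
    ∃ a : ℤ → ℝ, (∀ k, a (k + n) = a k + 1) ∧ ∀ k, a k = c (k % n) + (k / n : ℤ) := by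
  refine ⟨fun k => c (k % n) + (k / n : ℤ), fun k => ?_, fun k => rfl⟩
  have hn' : (n : ℤ) ≠ 0 := by omega
  simp only [Int.add_emod_right, Int.add_ediv_of_dvd_right dvd_rfl, Int.ediv_self hn']
  push_cast
  ring

theorem exists_isEnum {n : ℕ} (hn : 0 < n) {S : Set UnitAddCircle} (hS : S.encard = n) :
    ∃ a, IsEnum n S a := by
  have : Fact ((0 : ℝ) < 1) := ⟨one_pos⟩
  let e : UnitAddCircle → ℝ := fun y => (AddCircle.equivIco (1 : ℝ) 0 y : ℝ)
  have he : ∀ y, (e y : UnitAddCircle) = y := fun _ => AddCircle.coe_equivIco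
  have he' : ∀ y, 0 ≤ e y ∧ e y < 1 := fun y => by
    have := (AddCircle.equivIco (1 : ℝ) 0 y).2
    simpa using this
  have hinj : Function.Injective e := fun x y h => by rw [← he x, ← he y, h]
  have hT : (e '' S).encard = n := by rw [hinj.encard_image, hS]
  have hfin : (e '' S).Finite := Set.finite_of_encard_eq_coe hT
  have hcard : hfin.toFinset.card = n := by
    rw [hfin.encard_eq_coe_toFinset_card] at hT
    exact_mod_cast hT
  let o := hfin.toFinset.orderEmbOfFin hcard
  have ho : ∀ i, o i ∈ e '' S := fun i => by
    have := Finset.orderEmbOfFin_mem hfin.toFinset hcard i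
    rwa [Set.Finite.mem_toFinset] at this
  have ho1 : ∀ i, 0 ≤ o i ∧ o i < 1 := fun i => by
    obtain ⟨y, -, hy⟩ := ho i
    rw [← hy]; exact he' y
  have ho2 : ∀ i, (o i : UnitAddCircle) ∈ S := fun i => by
    obtain ⟨y, hyS, hy⟩ := ho i
    rw [← hy, he]; exact hyS
  -- The default `0` is immaterial: `c` is evaluated only at residues `k % n`.
  let c : ℤ → ℝ := fun k => if h : k.toNat < n then o ⟨k.toNat, h⟩ else 0
  have hc : ∀ k : ℤ, k < n → ∃ i : Fin n, c k = o i ∧ (i : ℕ) = k.toNat := fun k hk => by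
    have : k.toNat < n := by omega
    exact ⟨⟨k.toNat, this⟩, by simp [c, this], rfl⟩
  obtain ⟨a, hap, ha⟩ := exists_periodic_extension hn c
  have hn' : (0 : ℤ) < n := by exact_mod_cast hn
  have hemod : ∀ k : ℤ, 0 ≤ k % n ∧ k % n < n := fun k =>
    ⟨Int.emod_nonneg k hn'.ne', Int.emod_lt_of_pos k hn'⟩
  refine ⟨a, IsEnum.of_mem (strictMono_int_of_lt_succ fun k => ?_) hap (fun k => ?_) hS⟩
  · obtain ⟨i, hi, hik⟩ := hc _ (hemod k).2
    obtain ⟨j, hj, hjk⟩ := hc _ (hemod (k + 1)).2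
    rw [ha, ha, hi, hj]
    have := hemod k
    rcases ediv_emod_succ hn k with ⟨h1, h2⟩ | ⟨h1, h2, -⟩
    · rw [h1]
      have : o i < o j := o.strictMono (by rw [Fin.lt_def]; omega)
      linarith
    · rw [h1]
      push_cast
      linarith [(ho1 i).2, (ho1 j).1]
  · obtain ⟨i, hi, hik⟩ := hc _ (hemod k).2
    have : (a k : UnitAddCircle) = (o i : UnitAddCircle) := by
      rw [eq_comm, coe_eq_coe_iff]
      exact ⟨k / n, by rw [ha, hi]⟩
    rw [this]
    exact ho2 i

/-! ### Continuous enumerations of the values -/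

/-- Near `x₀`, the values of an `n`-valued map have enumerations close to a given one. -/
theorem IsNValuedMap.eventually_isEnum {X : Type*} [TopologicalSpace X] {n : ℕ}
    {f : X → Set UnitAddCircle} (hf : IsNValuedMap n f) {x₀ : X} {a : ℤ → ℝ}
    (ha : IsEnum n (f x₀) a) {ε : ℝ} (hε : 0 < ε) :
    ∀ᶠ x in 𝓝 x₀, ∃ b, IsEnum n (f x) b ∧ ∀ k, |b k - a k| < ε := by
  obtain ⟨δ, hδ, hgap⟩ := ha.exists_gap
  have hn' : (0 : ℤ) < n := by exact_mod_cast ha.pos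
  -- Points moved by less than half the minimal gap stay in increasing order. Lower semicontinuity
  -- provides `n` such points of `f x`, and the cardinality of `f x` excludes any others.
  set η := min ε (δ / 2) with hη
  have hη0 : 0 < η := lt_min hε (by positivity)
  have hlow := lowerHemicontinuous_iff_isOpen_inter_nonempty.1 hf.lower
  have hev : ∀ᶠ x in 𝓝 x₀, ∀ i ∈ Finset.range n,
      (f x ∩ ((fun y : ℝ => (y : UnitAddCircle)) '' Metric.ball (a i) η)).Nonempty := by
    rw [Filter.eventually_all_finset]
    intro i _
    refine (hlow _ (QuotientAddGroup.isOpenMap_coe _ Metric.isOpen_ball)).mem_nhds ?_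
    exact ⟨a i, ha.coe_mem i, a i, Metric.mem_ball_self hη0, rfl⟩
  filter_upwards [hev] with x hx
  have hx' : ∀ k : ℤ, ∃ y : ℝ, 0 ≤ k → k < n → (y : UnitAddCircle) ∈ f x ∧ |y - a k| < η := by
    intro k
    by_cases hk : 0 ≤ k ∧ k < n
    · obtain ⟨_, hyf, y, hy, rfl⟩ := hx k.toNat (by simp; omega)
      rw [Int.toNat_of_nonneg hk.1, Metric.mem_ball, Real.dist_eq] at hy
      exact ⟨y, fun _ _ => ⟨hyf, hy⟩⟩
    · exact ⟨0, fun h1 h2 => absurd ⟨h1, h2⟩ hk⟩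
  choose c hc using hx'
  obtain ⟨b, hbp, hb⟩ := exists_periodic_extension ha.pos c
  have hbc : ∀ k, (b k : UnitAddCircle) ∈ f x ∧ |b k - a k| < η := by
    intro k
    obtain ⟨h1, h2⟩ := hc (k % n) (Int.emod_nonneg k hn'.ne') (Int.emod_lt_of_pos k hn')
    rw [hb, eq_emod_add_ediv ha.add_period k, add_sub_add_right_eq_sub]
    refine ⟨?_, h2⟩
    rwa [← coe_eq_coe_iff.2 ⟨k / n, rfl⟩]
  refine ⟨b, IsEnum.of_mem (strictMono_int_of_lt_succ fun k => ?_) hbp (fun k => (hbc k).1)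
    (hf.encard_eq x), fun k => (hbc k).2.trans_le (min_le_left _ _)⟩
  have h1 := abs_lt.1 ((hbc k).2.trans_le (min_le_right _ _))
  have h2 := abs_lt.1 ((hbc (k + 1)).2.trans_le (min_le_right _ _))
  linarith [hgap k, h1.2, h2.1]

theorem abs_sum_sub_sum_lt {n : ℕ} {a b : ℤ → ℝ} {ε : ℝ} (hε : 0 < ε)
    (h : ∀ k, |b k - a k| < ε / (n + 1)) :
    |∑ i ∈ Finset.range n, b i - ∑ i ∈ Finset.range n, a i| < ε := by
  rw [← Finset.sum_sub_distrib]
  refine (Finset.abs_sum_le_sum_abs _ _).trans_lt ?_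
  calc _ ≤ ∑ _i ∈ Finset.range n, ε / (n + 1) := Finset.sum_le_sum fun i _ => (h i).le
    _ = n * (ε / (n + 1)) := by simp
    _ < ε := by
      rw [mul_div_assoc', div_lt_iff₀ (by positivity)]
      nlinarith

/-- The sum of the values is an ordinary circle-valued map, so covering theory applies to it; a real
lift of it will single out one enumeration at each point. -/
theorem IsNValuedMap.continuous_finsum {X : Type*} [TopologicalSpace X] {n : ℕ} (hn : 0 < n)
    {f : X → Set UnitAddCircle} (hf : IsNValuedMap n f) :
    Continuous fun x => ∑ᶠ y ∈ f x, y := by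
  rw [continuous_iff_continuousAt]
  intro x₀
  obtain ⟨a, ha⟩ := exists_isEnum hn (hf.encard_eq x₀)
  intro U hU
  beta_reduce at hU
  rw [ha.finsum_mem] at hU
  have hU' := (AddCircle.continuous_mk' (1 : ℝ)).continuousAt.preimage_mem_nhds hU
  obtain ⟨δ, hδ, hball⟩ := Metric.mem_nhds_iff.1 hU'
  rw [Filter.mem_map]
  filter_upwards [hf.eventually_isEnum ha (ε := δ / (n + 1)) (by positivity)] with x ⟨b, hb, hba⟩
  rw [Set.mem_preimage, hb.finsum_mem]
  refine hball ?_
  rw [Metric.mem_ball, Real.dist_eq]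
  exact abs_sum_sub_sum_lt hδ hba

/-- A lift of the sum of the values of an `n`-valued map determines continuous enumerations. -/
theorem IsNValuedMap.exists_continuous_enum {X : Type*} [TopologicalSpace X] {n : ℕ} (hn : 0 < n)
    {f : X → Set UnitAddCircle} (hf : IsNValuedMap n f) {s : X → ℝ} (hs : Continuous s)
    (hsf : ∀ x, (s x : UnitAddCircle) = ∑ᶠ y ∈ f x, y) :
    ∃ F : ℤ → X → ℝ, (∀ k, Continuous (F k)) ∧ ∀ x, IsEnum n (f x) fun k => F k x := by
  have hex : ∀ x, ∃ a, IsEnum n (f x) a ∧ ∑ i ∈ Finset.range n, a i = s x := by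
    intro x
    obtain ⟨a, ha⟩ := exists_isEnum hn (hf.encard_eq x)
    have h1 := hsf x
    rw [ha.finsum_mem, eq_comm, coe_eq_coe_iff] at h1
    obtain ⟨q, hq⟩ := h1
    exact ⟨_, ha.shift q, by rw [IsEnum.sum_shift ha.add_period, hq]⟩
  choose G hG hGs using hex
  refine ⟨fun k x => G x k, fun k => ?_, hG⟩
  rw [continuous_iff_continuousAt]
  intro x₀
  rw [Metric.continuousAt_iff']
  intro ε hε
  have h1 := Metric.continuousAt_iff'.1 (hs.continuousAt (x := x₀)) (1 / 2) (by norm_num)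
  have h2 := hf.eventually_isEnum (hG x₀) (ε := min ε (1 / 2 / (n + 1))) (by positivity)
  filter_upwards [h1, h2] with x hx1 ⟨b, hb, hba⟩
  have h3 := abs_sum_sub_sum_lt (n := n) (a := G x₀) (b := b) (ε := 1 / 2) (by norm_num)
    fun k => (hba k).trans_le (min_le_right _ _)
  have h4 := hsf x
  rw [hb.finsum_mem, coe_eq_coe_iff] at h4
  obtain ⟨q, hq⟩ := h4
  rw [Real.dist_eq] at hx1
  rw [hGs] at h3
  -- Both `s x` and the sum of `b` are within `1/2` of `s x₀`, so their integer difference `q`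
  -- vanishes and `b` is the chosen enumeration.
  have h5 : |(q : ℝ)| < 1 := by
    rw [abs_lt] at *
    constructor <;> linarith [hx1.1, hx1.2, h3.1, h3.2]
  have h6 : q = 0 := by
    rw [← Int.abs_lt_one_iff]
    exact_mod_cast h5
  have h7 : G x = b := (hG x).eq_of_sum_eq hb (by rw [hGs, hq, h6]; simp)
  rw [Real.dist_eq, h7]
  exact (hba k).trans_le (min_le_left _ _)

/-- A continuous selection from a locally discrete family of graphs is one of the graphs. -/
theorem exists_eq_of_selection {X : Type*} [TopologicalSpace X] [PreconnectedSpace X] [Nonempty X]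
    {F : ℤ → X → ℝ} (hF : ∀ k, Continuous (F k)) (hmono : ∀ x, StrictMono fun k => F k x)
    {u : X → ℝ} (hu : Continuous u) (hsel : ∀ x, ∃ k, F k x = u x) :
    ∃ k, ∀ x, F k x = u x := by
  obtain ⟨x₀⟩ := ‹Nonempty X›
  obtain ⟨k, hk⟩ := hsel x₀
  refine ⟨k, fun x => ?_⟩
  have hclosed : IsClosed {x | F k x = u x} := isClosed_eq (hF k) hu
  have hopen : IsOpen {x | F k x = u x} := by
    -- Openness: `u x` is one of the discrete values `F l x`, so lying strictly between the
    -- neighbours of `F k x` forces `l = k`.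
    have : {x | F k x = u x} = {x | F (k - 1) x < u x} ∩ {x | u x < F (k + 1) x} := by
      ext x
      simp only [Set.mem_ofPred_eq, Set.mem_inter_iff]
      constructor
      · intro h
        rw [← h]
        exact ⟨hmono x (by omega : k - 1 < k), hmono x (by omega : k < k + 1)⟩
      · rintro ⟨h1, h2⟩
        obtain ⟨l, hl⟩ := hsel x
        rw [← hl] at h1 h2 ⊢
        have h3 := (hmono x).lt_iff_lt.1 h1
        have h4 := (hmono x).lt_iff_lt.1 h2
        rw [show k = l by omega]
    rw [this]
    exact (isOpen_lt (hF _) hu).inter (isOpen_lt hu (hF _))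
  have := IsClopen.eq_univ ⟨hclosed, hopen⟩ ⟨x₀, hk⟩
  exact this.ge (Set.mem_univ x)

/-! ### Lifts of `n`-valued maps and homotopies -/

/-- `F` is the increasing family of all lifts of the `n`-valued self-map `f` of the circle,
and going once around the circle shifts the index by `d`. -/
structure IsLift (n : ℕ) (d : ℤ) (f : UnitAddCircle → Set UnitAddCircle) (F : ℤ → ℝ → ℝ) :
    Prop where
  continuous : ∀ k, Continuous (F k)
  isEnum : ∀ t : ℝ, IsEnum n (f t) fun k => F k t
  add_one : ∀ k t, F k (t + 1) = F (k + d) t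

theorem IsNValuedMap.comp {X Y Z : Type*} [TopologicalSpace X] [TopologicalSpace Y]
    [TopologicalSpace Z] {n : ℕ} {f : Y → Set Z} (hf : IsNValuedMap n f) {q : X → Y}
    (hq : Continuous q) : IsNValuedMap n (f ∘ q) :=
  ⟨fun x => hf.encard_eq (q x), hf.upper.comp hq, hf.lower.comp hq⟩

theorem exists_lift_circle {X : Type*} [TopologicalSpace X] [SimplyConnectedSpace X]
    [LocallyPathConnectedSpace X] {s : X → UnitAddCircle} (hs : Continuous s) :
    ∃ u : X → ℝ, Continuous u ∧ ∀ x, (u x : UnitAddCircle) = s x := by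
  obtain ⟨x₀⟩ : Nonempty X := inferInstance
  obtain ⟨e₀, he⟩ := QuotientAddGroup.mk_surjective (s x₀)
  obtain ⟨u, ⟨-, hu⟩, -⟩ := (AddCircle.isCoveringMap_coe (1 : ℝ)).existsUnique_continuousMap_lifts
    ⟨s, hs⟩ x₀ e₀ he
  exact ⟨u, u.continuous, fun x => congrFun hu x⟩

/-- The ends of an `n`-valued homotopy have lifts with the same degree. -/
theorem IsNValuedMap.exists_isLift_homotopy {n : ℕ} (hn : 0 < n)
    {H : UnitAddCircle × I → Set UnitAddCircle} (hH : IsNValuedMap n H) :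
    ∃ d F F', IsLift n d (fun x => H (x, 0)) F ∧ IsLift n d (fun x => H (x, 1)) F' := by
  -- The homotopy is extended constantly beyond `[0,1]` and pulled back to the plane, which is
  -- simply connected.
  let q : ℝ × ℝ → UnitAddCircle × I := fun p => (p.1, Set.projIcc 0 1 zero_le_one p.2)
  have hq : Continuous q :=
    ((AddCircle.continuous_mk' (1 : ℝ)).comp continuous_fst).prodMk
      (continuous_projIcc.comp continuous_snd)
  have hHq := hH.comp hq
  obtain ⟨s, hs, hsH⟩ := exists_lift_circle (hHq.continuous_finsum hn)
  obtain ⟨F, hF, hFe⟩ := hHq.exists_continuous_enum hn hs hsH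
  have hqp : ∀ t r : ℝ, (H ∘ q) (t + 1, r) = (H ∘ q) (t, r) := by
    intro t r
    have : ((t + 1 : ℝ) : UnitAddCircle) = t := (coe_eq_coe_iff.2 ⟨1, by simp⟩).symm
    simp only [Function.comp_apply, q, this]
  have hadd : Continuous fun p : ℝ × ℝ => (p.1 + 1, p.2) := by fun_prop
  -- The translate of `F 0` selects among the `F k`, so its index is constant on the plane; in
  -- particular both ends of the homotopy have the same shift.
  obtain ⟨d, hd⟩ := exists_eq_of_selection hF (fun x => (hFe x).strictMono)
    ((hF 0).comp hadd) fun p => ((hFe p).coe_mem_iff _).1 <| by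
      have := (hFe (p.1 + 1, p.2)).coe_mem 0
      rwa [hqp] at this
  have hshift : ∀ k t r, F k (t + 1, r) = F (k + d) (t, r) := by
    intro k t r
    have h1 := hFe (t + 1, r)
    rw [hqp] at h1
    obtain ⟨c, hc⟩ := (hFe (t, r)).exists_shift h1
    have h2 := hd (t, r)
    rw [Function.comp_apply, hc, zero_add] at h2
    rw [hc, (hFe (t, r)).strictMono.injective h2]
  have hlift : ∀ r : I, IsLift n d (fun x => H (x, r)) fun k t => F k (t, r) := fun r =>
    { continuous := fun k => (hF k).comp (by fun_prop)
      isEnum := fun t => by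
        have := hFe (t, r)
        simpa only [Function.comp_apply, q, Set.projIcc_val] using this
      add_one := fun k t => hshift k t r }
  exact ⟨d, _, _, hlift 0, hlift 1⟩

theorem IsNValuedMap.exists_isLift {n : ℕ} (hn : 0 < n) {f : UnitAddCircle → Set UnitAddCircle}
    (hf : IsNValuedMap n f) : ∃ d F, IsLift n d f F := by
  obtain ⟨d, F, -, hF, -⟩ := (hf.comp (continuous_fst (Y := I))).exists_isLift_homotopy hn
  exact ⟨d, F, hF⟩

/-- A family of continuous enumerations defined on a cover of `X` gives an `n`-valued map. -/
theorem isNValuedMap_of_isQuotientMap {X X' : Type*} [TopologicalSpace X] [TopologicalSpace X']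
    {n : ℕ} {f : X → Set UnitAddCircle} {q : X' → X} (hq : IsQuotientMap q) {F : ℤ → X' → ℝ}
    (hF : ∀ k, Continuous (F k)) (hFe : ∀ x, IsEnum n (f (q x)) fun k => F k x) :
    IsNValuedMap n f where
  encard_eq x := by
    obtain ⟨x', rfl⟩ := hq.surjective x
    exact (hFe x').encard_eq
  upper := by
    rw [upperHemicontinuous_iff_isOpen_preimage_Iic]
    intro U hU
    rw [← hq.isOpen_preimage]
    have : q ⁻¹' (f ⁻¹' Set.Iic U) =
        ⋂ i ∈ Finset.range n, {x | (F i x : UnitAddCircle) ∈ U} := by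
      ext x
      simp only [Set.mem_preimage, Set.mem_Iic, Set.mem_iInter, Set.mem_ofPred_eq]
      rw [(hFe x).eq_image, Set.image_subset_iff]
      exact Iff.rfl
    rw [this]
    exact isOpen_biInter_finset fun i _ =>
      hU.preimage ((AddCircle.continuous_mk' (1 : ℝ)).comp (hF i))
  lower := by
    rw [lowerHemicontinuous_iff_isOpen_inter_nonempty]
    intro U hU
    rw [← hq.isOpen_preimage]
    have : q ⁻¹' {x | (f x ∩ U).Nonempty} =
        ⋃ k, {x | (F k x : UnitAddCircle) ∈ U} := by
      ext x
      simp only [Set.mem_preimage, Set.mem_ofPred_eq, Set.mem_iUnion]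
      rw [(hFe x).eq_range]
      constructor
      · rintro ⟨_, ⟨k, rfl⟩, h⟩
        exact ⟨k, h⟩
      · rintro ⟨k, h⟩
        exact ⟨_, ⟨k, rfl⟩, h⟩
    rw [this]
    exact isOpen_iUnion fun k => hU.preimage ((AddCircle.continuous_mk' (1 : ℝ)).comp (hF k))

theorem isOpenQuotientMap_coe : IsOpenQuotientMap ((↑) : ℝ → UnitAddCircle) :=
  ⟨QuotientAddGroup.mk_surjective, AddCircle.continuous_mk' (1 : ℝ),
    QuotientAddGroup.isOpenMap_coe⟩

theorem IsLift.isNValuedMap {n : ℕ} {d : ℤ} {f : UnitAddCircle → Set UnitAddCircle}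
    {F : ℤ → ℝ → ℝ} (hF : IsLift n d f F) : IsNValuedMap n f :=
  isNValuedMap_of_isQuotientMap isOpenQuotientMap_coe.isQuotientMap hF.continuous hF.isEnum

theorem add_int_of_add_one {d : ℤ} {F : ℤ → ℝ → ℝ} (h : ∀ k t, F k (t + 1) = F (k + d) t)
    (k q : ℤ) (t : ℝ) : F k (t + q) = F (k + d * q) t := by
  induction q using Int.induction_on generalizing t k with
  | zero => simp
  | succ i ih =>
    push_cast
    rw [← add_assoc, h]
    have := ih (k + d) t
    push_cast at this
    rw [this]
    congr 1
    ring
  | pred i ih =>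
    have h1 := h (k - d) (t + ((-(i : ℤ) - 1 : ℤ) : ℝ))
    rw [sub_add_cancel] at h1
    rw [← h1]
    have := ih (k - d) t
    rw [show t + ((-(i : ℤ) - 1 : ℤ) : ℝ) + 1 = t + ((-(i : ℤ) : ℤ) : ℝ) by push_cast; ring, this]
    congr 1
    ring

/-- A family of real functions with the right periodicity defines a map with these lifts. -/
theorem exists_isLift_of_family {n : ℕ} {d : ℤ} {F : ℤ → ℝ → ℝ} (hc : ∀ k, Continuous (F k))
    (hm : ∀ t, StrictMono fun k => F k t) (hp : ∀ k t, F (k + n) t = F k t + 1)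
    (ha : ∀ k t, F k (t + 1) = F (k + d) t) : ∃ f, IsLift n d f F := by
  refine ⟨fun x => {y | ∃ t : ℝ, (t : UnitAddCircle) = x ∧ ∃ k, (F k t : UnitAddCircle) = y},
    hc, fun t => ?_, ha⟩
  convert IsEnum.of_strictMono (hm t) (fun k => hp k t) using 1
  ext y
  constructor
  · rintro ⟨s, hs, k, rfl⟩
    obtain ⟨q, rfl⟩ := coe_eq_coe_iff.1 hs.symm
    exact ⟨k + d * q, by rw [add_int_of_add_one ha]⟩
  · rintro ⟨k, rfl⟩
    exact ⟨t, rfl, k, rfl⟩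

/-- Convex combinations of increasing families are increasing, and the two periodicity relations
survive because `n` and `d` are common to both families. -/
theorem IsLift.nHomotopic {n : ℕ} {d : ℤ} {f f' : UnitAddCircle → Set UnitAddCircle}
    {F F' : ℤ → ℝ → ℝ} (hF : IsLift n d f F) (hF' : IsLift n d f' F') : NHomotopic n f f' := by
  have hcomb : ∀ r : I, ∃ g, IsLift n d g fun k t => (1 - (r : ℝ)) * F k t + r * F' k t := by
    intro r
    refine exists_isLift_of_family (fun k => ?_) (fun t k l hkl => ?_) (fun k t => ?_)
      (fun k t => ?_)
    · exact (continuous_const.mul (hF.continuous k)).add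
        (continuous_const.mul (hF'.continuous k))
    · have h1 := (hF.isEnum t).strictMono hkl
      have h2 := (hF'.isEnum t).strictMono hkl
      have h3 := r.2.1
      have h4 := r.2.2
      beta_reduce at h1 h2 ⊢
      rcases h3.eq_or_lt with h0 | h0
      · rw [← h0]; linarith
      · nlinarith
    · rw [(hF.isEnum t).add_period, (hF'.isEnum t).add_period]
      ring
    · rw [hF.add_one, hF'.add_one]
  choose G hG using hcomb
  have hend : ∀ (r : I) (g : UnitAddCircle → Set UnitAddCircle) (E : ℤ → ℝ → ℝ),
      IsLift n d g E → (∀ k t, (1 - (r : ℝ)) * F k t + r * F' k t = E k t) → G r = g := by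
    intro r g E hE h
    funext x
    obtain ⟨t, rfl⟩ := QuotientAddGroup.mk_surjective x
    refine ((hG r).isEnum t).eq_range.trans (Eq.trans ?_ (hE.isEnum t).eq_range.symm)
    simp only [h]
  refine ⟨fun p => G p.2 p.1, ?_, fun x => ?_, fun x => ?_⟩
  · refine isNValuedMap_of_isQuotientMap
      (isOpenQuotientMap_coe.prodMap (IsOpenQuotientMap.id (X := I))).isQuotientMap
      (F := fun k p => (1 - (p.2 : ℝ)) * F k p.1 + p.2 * F' k p.1) (fun k => ?_)
      fun p => (hG p.2).isEnum p.1
    have h1 := hF.continuous k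
    have h2 := hF'.continuous k
    fun_prop
  · exact congrFun (hend 0 f F hF (by simp)) x
  · exact congrFun (hend 1 f' F' hF' (by simp)) x

/-! ### The index shift is the degree -/

section Degree

variable {n : ℕ} {d : ℤ} {f : UnitAddCircle → Set UnitAddCircle} {F : ℤ → ℝ → ℝ}

theorem IsLift.hasDegree (hF : IsLift n d f F) : HasDegree n f d := by
  have h0 := hF.isEnum 0
  have hn := h0.pos
  have hn' : (0 : ℤ) < n := by exact_mod_cast hn
  have hsurj : ∀ q : ℤ, F (n * q) 0 = F 0 0 + q := fun q => by
    have := h0.add_mul 0 q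
    rwa [zero_add] at this
  -- With `c` the least index whose lift starts at or above `0`, the lifts of index `c, …, c + n -
  -- 1` are those starting in `[0,1)`.
  obtain ⟨c, hc, hmin⟩ := Int.exists_least_of_bdd (P := fun k => 0 ≤ F k 0)
    ⟨n * (-⌈F 0 0⌉ - 1), fun k hk => by
      by_contra hlt
      have h1 := h0.strictMono (not_le.1 hlt)
      beta_reduce at h1
      rw [hsurj] at h1
      push_cast at h1
      linarith [Int.le_ceil (F 0 0)]⟩
    ⟨n * -⌊F 0 0⌋, by
      rw [hsurj]
      push_cast
      linarith [Int.floor_le (F 0 0)]⟩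
  have hmono : StrictMono fun j : Fin n => F (c + (j : ℕ)) 0 := fun i j hij =>
    h0.strictMono (by have : (i : ℕ) < j := hij; omega)
  refine ⟨hn, fun j => ⟨fun t => F (c + (j : ℕ)) t,
    (hF.continuous _).comp continuous_subtype_val⟩, fun t => ?_, fun j => ?_, ?_,
    d / n, ⟨(d % n).toNat, ?_⟩, ?_, ?_⟩
  · rw [((hF.isEnum t).shift c).eq_image]
    ext y
    simp only [Set.mem_image, Finset.coe_range, Set.mem_Iio, Set.mem_range,
      ContinuousMap.coe_mk]
    constructor
    · rintro ⟨i, hi, rfl⟩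
      exact ⟨⟨i, hi⟩, by simp only [add_comm]⟩
    · rintro ⟨j, rfl⟩
      exact ⟨j, j.2, by simp only [add_comm]⟩
  · simp only [ContinuousMap.coe_mk, Set.Icc.coe_zero, Set.mem_Ico]
    constructor
    · exact hc.trans (h0.strictMono.monotone (by omega))
    · by_contra hge
      have h1 := h0.add_period (c + (j : ℕ) - n)
      rw [sub_add_cancel] at h1
      have := hmin (c + (j : ℕ) - n) (by linarith)
      have := j.2
      omega
  · simpa using hmono
  · have := Int.emod_lt_of_pos d hn'
    omega
  · simp only [ContinuousMap.coe_mk, Set.Icc.coe_zero, Set.Icc.coe_one]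
    rw [Int.toNat_of_nonneg (Int.emod_nonneg d hn'.ne')]
    have h1 := h0.add_mul (c + d % n) (d / n)
    rw [add_assoc c, Int.emod_add_mul_ediv] at h1
    have h2 := hF.add_one c 0
    rw [zero_add] at h2
    simp only [Nat.cast_zero, add_zero]
    rw [h2, h1]
    ring
  · simp only
    rw [Int.toNat_of_nonneg (Int.emod_nonneg d hn'.ne')]
    linarith [Int.emod_add_mul_ediv d n]

/-- The `n` integers lie in a window of length `n`, which leaves no room for gaps. -/
theorem fin_strictMono_eq_add {κ : Fin n → ℤ} (hκ : StrictMono κ) (hn : 0 < n)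
    (hlt : ∀ j, κ j < κ ⟨0, hn⟩ + n) (j : Fin n) : κ j = κ ⟨0, hn⟩ + (j : ℕ) := by
  have hstep : ∀ (i k : ℕ) (hi : i + k < n), κ ⟨i, by omega⟩ + k ≤ κ ⟨i + k, hi⟩ := by
    intro i k
    induction k with
    | zero => intro hi; simp
    | succ k ih =>
      intro hi
      have h1 := ih (by omega)
      have h2 : κ ⟨i + k, by omega⟩ < κ ⟨i + (k + 1), hi⟩ := hκ (by rw [Fin.lt_def]; simp)
      push_cast
      omega
  have hj := j.2
  have h1 := hstep 0 j (by omega)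
  have h2 := hstep j (n - 1 - j) (by omega)
  have h3 := hlt ⟨j + (n - 1 - j), by omega⟩
  simp only [zero_add, Fin.eta] at h1 h2
  omega

/-- Each path of the given splitting is some `F k`, and the normalised starting points make these
indices consecutive. Comparing the indices at the end of path `0` gives the shift `n * v + J`. -/
theorem IsLift.eq_of_hasDegree (hF : IsLift n d f F) {e : ℤ} (he : HasDegree n f e) : e = d := by
  obtain ⟨hn, E, hE, hE0, hEm, v, J, hv, rfl⟩ := he
  have hsel : ∀ j, ∃ k, ∀ t : I, F k t = E j t := fun j =>
    exists_eq_of_selection (X := I) (fun k => (hF.continuous k).comp continuous_subtype_val)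
      (fun t => (hF.isEnum t).strictMono) (E j).continuous fun t =>
      ((hF.isEnum t).coe_mem_iff _).1 <| by
        rw [hE]
        exact ⟨j, rfl⟩
  choose κ hκ using hsel
  have h0 := hF.isEnum 0
  have hκ0 : ∀ j, F (κ j) 0 = E j 0 := fun j => by simpa using hκ j 0
  have hκm : StrictMono κ := fun i j hij => by
    have := hEm hij
    beta_reduce at this
    rw [← hκ0, ← hκ0] at this
    exact h0.strictMono.lt_iff_lt.1 this
  have hκJ := fin_strictMono_eq_add hκm hn (fun j => by
    refine h0.strictMono.lt_iff_lt.1 ?_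
    rw [h0.add_period]
    rw [hκ0, hκ0]
    linarith [(hE0 j).2, (hE0 ⟨0, hn⟩).1]) J
  have h1 := hκ ⟨0, hn⟩ 1
  have h2 := hF.add_one (κ ⟨0, hn⟩) 0
  have h3 := h0.add_mul (κ J) v
  beta_reduce at h3
  rw [hκ0] at h3
  rw [zero_add] at h2
  rw [hv, Set.Icc.coe_one, h2, add_comm (v : ℝ), ← h3] at h1
  have h4 := h0.strictMono.injective h1
  linarith

theorem IsLift.degree_eq (hF : IsLift n d f F) : degree n f = d := by
  have h : ∃ d, HasDegree n f d := ⟨d, hF.hasDegree⟩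
  rw [degree, dif_pos h]
  exact hF.eq_of_hasDegree h.choose_spec

/-- Homotopic maps have lifts of the same degree. -/
theorem NHomotopic.exists_isLift (hF : IsLift n d f F) {f' : UnitAddCircle → Set UnitAddCircle}
    (h : NHomotopic n f f') : ∃ F', IsLift n d f' F' := by
  obtain ⟨H, hH, hH0, hH1⟩ := h
  obtain ⟨e, G, G', hG, hG'⟩ := hH.exists_isLift_homotopy (hF.isEnum 0).pos
  simp only [hH0, hH1] at hG hG'
  have : e = d := by rw [← hG.degree_eq, ← hF.degree_eq]
  exact ⟨G', this ▸ hG'⟩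

end Degree

/-! ### Power maps as affine families -/

section PowerMap

variable {n : ℕ}

theorem exists_isLift_affine (hn : 0 < n) (d : ℤ) (c : ℝ) :
    ∃ f, IsLift n d f fun k t => (d : ℝ) / n * t + k / n + c := by
  have hn' : (0 : ℝ) < n := by exact_mod_cast hn
  refine exists_isLift_of_family (fun k => by fun_prop) (fun t k l hkl => ?_) (fun k t => ?_)
    (fun k t => ?_)
  · have : (k : ℝ) < l := by exact_mod_cast hkl
    beta_reduce
    gcongr
  · push_cast
    field_simp
    ring
  · push_cast
    field_simp
    ring

theorem isLift_powerMap (hn : 0 < n) (d : ℤ) :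
    IsLift n d (powerMap n d) fun k t => (d : ℝ) / n * t + k / n := by
  obtain ⟨f, hf⟩ := exists_isLift_affine hn d 0
  simp only [add_zero] at hf
  have : powerMap n d = f := by
    funext x
    obtain ⟨t, rfl⟩ := QuotientAddGroup.mk_surjective x
    refine (powerMap_coe n d t).trans (Eq.trans ?_ (hf.isEnum t).eq_image.symm)
    ext y
    simp only [Set.mem_image, Finset.coe_range, Set.mem_Iio, Set.mem_range, Int.cast_natCast]
    exact ⟨fun ⟨u, hu⟩ => ⟨u, u.2, hu⟩, fun ⟨i, hi, hu⟩ => ⟨⟨i, hi⟩, hu⟩⟩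
  rw [this]
  exact hf

end PowerMap

/-! ### Counting coincidences by lattice classes -/

/-- The index of the lattice spanned by two vectors of `ℤ × ℤ`. -/
theorem card_quotient_span_pair {p q r s : ℤ} (hD : p * s - q * r ≠ 0) :
    Nat.card ((ℤ × ℤ) ⧸ Submodule.span ℤ {((p, q) : ℤ × ℤ), (r, s)}) =
      (p * s - q * r).natAbs := by
  have hli : LinearIndependent ℤ ![((p, q) : ℤ × ℤ), (r, s)] := by
    rw [LinearIndependent.pair_iff]
    intro x y h
    simp only [Prod.smul_mk, smul_eq_mul, Prod.mk_add_mk, Prod.mk_eq_zero] at h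
    obtain ⟨h1, h2⟩ := h
    constructor
    · refine (mul_eq_zero.1 ?_).resolve_right hD
      linear_combination s * h1 - r * h2
    · refine (mul_eq_zero.1 ?_).resolve_right hD
      linear_combination p * h2 - q * h1
  have hr : Set.range ![((p, q) : ℤ × ℤ), (r, s)] = {((p, q) : ℤ × ℤ), (r, s)} := by
    simp [Matrix.range_cons, Set.pair_comm]
  have h := Submodule.natAbs_det_basis_change (Module.Basis.finTwoProd ℤ) _
    (Module.Basis.span hli)
  rw [← hr, ← h, Module.Basis.det_apply, Matrix.det_fin_two]
  simp only [Module.Basis.toMatrix_apply, Function.comp_apply, Module.Basis.span_apply]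
  congr 1
  simp
  ring

section Count

variable {n m : ℕ} {a b : ℤ} {f g : UnitAddCircle → Set UnitAddCircle} {F G : ℤ → ℝ → ℝ}

theorem IsLift.mem_graphCoin_iff (hF : IsLift n a f F) (hG : IsLift m b g G)
    {p : UnitAddCircle × UnitAddCircle} :
    p ∈ graphCoin f g ↔
      ∃ t k l, F k t = G l t ∧ p = ((t : UnitAddCircle), (F k t : UnitAddCircle)) := by
  obtain ⟨x, y⟩ := p
  constructor
  · rintro ⟨h1, h2⟩
    obtain ⟨t, rfl⟩ := QuotientAddGroup.mk_surjective x
    obtain ⟨u, rfl⟩ := QuotientAddGroup.mk_surjective y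
    obtain ⟨k, rfl⟩ := ((hF.isEnum t).coe_mem_iff u).1 h1
    obtain ⟨l, hl⟩ := ((hG.isEnum t).coe_mem_iff _).1 h2
    exact ⟨t, k, l, hl.symm, rfl⟩
  · rintro ⟨t, k, l, h, hp⟩
    obtain ⟨rfl, rfl⟩ := Prod.mk.inj hp
    exact ⟨(hF.isEnum t).coe_mem k, by rw [h]; exact (hG.isEnum t).coe_mem l⟩

/-- The deck transformation `(i, j)` acts on the graphs of the lifts. Applied to `F` and `G` at
once, it moves `(k, l)` by `i (n, m) + j (a, b)`. -/
theorem IsLift.add_lattice (hF : IsLift n a f F) (k i j : ℤ) (t : ℝ) :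
    F (k + (i * n + j * a)) (t - j) = F k t + i := by
  have h1 := add_int_of_add_one hF.add_one (k + i * n) j (t - j)
  have h2 := (hF.isEnum t).add_mul k i
  rw [sub_add_cancel] at h1
  rw [← h2, mul_comm (n : ℤ), h1]
  congr 1
  ring

/-- The index of a coincidence is determined modulo the lattice of deck transformations. -/
theorem IsLift.sub_mem_span (hF : IsLift n a f F) (hG : IsLift m b g G) {k l k' l' : ℤ} {t t' : ℝ}
    (h : F k t = G l t) (h' : F k' t' = G l' t') (ht : (t : UnitAddCircle) = t')
    (hy : (F k t : UnitAddCircle) = F k' t') :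
    ((k', l') : ℤ × ℤ) - (k, l) ∈ Submodule.span ℤ {((n, m) : ℤ × ℤ), (a, b)} := by
  obtain ⟨j, rfl⟩ := coe_eq_coe_iff.1 ht
  obtain ⟨i, hi⟩ := coe_eq_coe_iff.1 hy
  have h1 := hF.add_lattice k i (-j) t
  have h2 := hG.add_lattice l i (-j) t
  rw [Int.cast_neg, sub_neg_eq_add] at h1 h2
  have e1 : k' = k + (i * n + -j * a) :=
    (hF.isEnum (t + j)).strictMono.injective (hi.trans h1.symm)
  have e2 : l' = l + (i * m + -j * b) :=
    (hG.isEnum (t + j)).strictMono.injective (by rw [h2, ← h', hi, h])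
  rw [Submodule.mem_span_pair]
  exact ⟨i, -j, by ext <;> simp [e1, e2]⟩

/-- Translating `t` by `n * m * j` changes `F k - G l` by `(a * m - b * n) * j`, so the difference
takes both signs. -/
theorem IsLift.exists_eq (hF : IsLift n a f F) (hG : IsLift m b g G) (hD : a * m ≠ b * n)
    (k l : ℤ) : ∃ t, F k t = G l t := by
  have key : ∀ j : ℤ, F k ((n * m * j : ℤ) : ℝ) - G l ((n * m * j : ℤ) : ℝ) =
      F k 0 - G l 0 + ((a * m - b * n) * j : ℤ) := by
    intro j
    have h1 := add_int_of_add_one hF.add_one k (n * m * j) 0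
    have h2 := add_int_of_add_one hG.add_one l (n * m * j) 0
    have h3 := (hF.isEnum 0).add_mul k (a * m * j)
    have h4 := (hG.isEnum 0).add_mul l (b * n * j)
    rw [zero_add] at h1 h2
    rw [show a * (n * m * j) = n * (a * m * j) by ring] at h1
    rw [show b * (n * m * j) = m * (b * n * j) by ring] at h2
    rw [h1, h2, h3, h4]
    push_cast
    ring
  have hcont : Continuous fun t => F k t - G l t := (hF.continuous k).sub (hG.continuous l)
  have hD' : a * m - b * n ≠ 0 := sub_ne_zero.2 hD
  obtain ⟨N, hN⟩ := exists_nat_ge |F k 0 - G l 0|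
  -- Taking `j = ±(a * m - b * n) * N` yields changes `±(a * m - b * n) ^ 2 * N` whose signs do not
  -- depend on that of `a * m - b * n`.
  have hsq : (N : ℝ) ≤ ((a * m - b * n) * ((a * m - b * n) * N) : ℤ) := by
    have h1 : 1 ≤ (a * m - b * n) ^ 2 := by
      have := sq_pos_of_ne_zero hD'
      omega
    have h2 : (N : ℤ) ≤ (a * m - b * n) * ((a * m - b * n) * N) := by
      nlinarith [Int.natCast_nonneg N]
    exact_mod_cast h2
  have h1 := key ((a * m - b * n) * N)
  have h2 := key (-((a * m - b * n) * N))
  rw [mul_neg (a * m - b * n), Int.cast_neg ((a * m - b * n) * ((a * m - b * n) * N))] at h2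
  have h3 := abs_le.1 hN
  obtain ⟨t, ht⟩ := mem_range_of_exists_le_of_exists_ge (c := 0) hcont
    ⟨_, h2.le.trans (by linarith [h3.2])⟩ ⟨_, le_trans (by linarith [h3.1]) h1.ge⟩
  exact ⟨t, sub_eq_zero.1 ht⟩

/-- Every class of pairs of lifts contributes a coincidence. -/
theorem IsLift.exists_injective_graphCoin (hF : IsLift n a f F) (hG : IsLift m b g G)
    (hD : a * m ≠ b * n) :
    ∃ P : (ℤ × ℤ) ⧸ Submodule.span ℤ {((n, m) : ℤ × ℤ), (a, b)} → UnitAddCircle × UnitAddCircle,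
      Function.Injective P ∧ Set.range P ⊆ graphCoin f g ∧
      ((∀ k l t t', F k t = G l t → F k t' = G l t' → t = t') → Set.range P = graphCoin f g) := by
  choose T hT using hF.exists_eq hG hD
  let P : (ℤ × ℤ) ⧸ Submodule.span ℤ {((n, m) : ℤ × ℤ), (a, b)} →
      UnitAddCircle × UnitAddCircle := fun c =>
    ((T c.out.1 c.out.2 : UnitAddCircle), (F c.out.1 (T c.out.1 c.out.2) : UnitAddCircle))
  have hsub : Set.range P ⊆ graphCoin f g := by
    rintro _ ⟨c, rfl⟩
    exact (hF.mem_graphCoin_iff hG).2 ⟨_, _, _, hT _ _, rfl⟩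
  have hout : ∀ c : (ℤ × ℤ) ⧸ Submodule.span ℤ {((n, m) : ℤ × ℤ), (a, b)},
      Submodule.Quotient.mk c.out = c := fun c => Quotient.out_eq c
  refine ⟨P, fun c c' h => ?_, hsub, fun huniq => hsub.antisymm fun p hp => ?_⟩
  · obtain ⟨h1, h2⟩ := Prod.mk.inj h
    have := hF.sub_mem_span hG (hT _ _) (hT _ _) h1 h2
    rw [← hout c, ← hout c', eq_comm, Submodule.Quotient.eq]
    exact this
  · obtain ⟨t, k, l, h, rfl⟩ := (hF.mem_graphCoin_iff hG).1 hp
    let c : (ℤ × ℤ) ⧸ Submodule.span ℤ {((n, m) : ℤ × ℤ), (a, b)} :=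
      Submodule.Quotient.mk (k, l)
    have hc : c.out - (k, l) ∈ Submodule.span ℤ {((n, m) : ℤ × ℤ), (a, b)} :=
      (Submodule.Quotient.eq _).1 (hout c)
    obtain ⟨i, j, hij⟩ := Submodule.mem_span_pair.1 hc
    have hk : c.out.1 = k + (i * n + j * a) := by
      have := congrArg Prod.fst hij
      simp at this
      linarith
    have hl : c.out.2 = l + (i * m + j * b) := by
      have := congrArg Prod.snd hij
      simp at this
      linarith
    have h1 := hF.add_lattice k i j t
    have h2 := hG.add_lattice l i j t
    rw [← hk] at h1
    rw [← hl] at h2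
    -- The coincidence, carried by the deck transformation to the chosen representative of its
    -- class, must be the chosen solution there.
    have h3 : T c.out.1 c.out.2 = t - j := huniq _ _ _ _ (hT _ _) (by rw [h1, h2, h])
    refine ⟨c, Prod.ext ?_ ?_⟩
    · exact coe_eq_coe_iff.2 ⟨j, by rw [h3]; ring⟩
    · exact (coe_eq_coe_iff.2 ⟨i, by rw [h3, h1]⟩).symm

theorem encard_range_of_lattice (hD : a * m ≠ b * n) {α : Type*}
    {P : (ℤ × ℤ) ⧸ Submodule.span ℤ {((n, m) : ℤ × ℤ), (a, b)} → α} (hP : Function.Injective P) :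
    (Set.range P).encard = ((a * m - b * n).natAbs : ℕ∞) := by
  have hcard := card_quotient_span_pair (p := n) (q := m) (r := a) (s := b)
    (fun h => hD (by linarith))
  have habs : ((n : ℤ) * b - m * a).natAbs = (a * m - b * n).natAbs := by
    rw [← Int.natAbs_neg]
    congr 1
    ring
  have hfin : Finite ((ℤ × ℤ) ⧸ Submodule.span ℤ {((n, m) : ℤ × ℤ), (a, b)}) := by
    refine Nat.finite_of_card_ne_zero ?_
    rw [hcard, habs, Int.natAbs_ne_zero]
    exact sub_ne_zero.2 hD
  rw [← Set.image_univ, hP.encard_image, Set.encard_univ, ENat.card_eq_coe_natCard, hcard, habs]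

theorem IsLift.natAbs_le_encard_graphCoin (hF : IsLift n a f F) (hG : IsLift m b g G)
    (hD : a * m ≠ b * n) : ((a * m - b * n).natAbs : ℕ∞) ≤ (graphCoin f g).encard := by
  obtain ⟨P, hP, hsub, -⟩ := hF.exists_injective_graphCoin hG hD
  rw [← encard_range_of_lattice hD hP]
  exact Set.encard_le_encard hsub

theorem encard_graphCoin_powerMap (hn : 0 < n) (hm : 0 < m) (hD : a * m ≠ b * n) :
    (graphCoin (powerMap n a) (powerMap m b)).encard = ((a * m - b * n).natAbs : ℕ∞) := by
  obtain ⟨P, hP, -, hr⟩ := (isLift_powerMap hn a).exists_injective_graphCoin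
    (isLift_powerMap hm b) hD
  rw [← hr, encard_range_of_lattice hD hP]
  intro k l t t' h h'
  have hn' : (n : ℝ) ≠ 0 := by positivity
  have hm' : (m : ℝ) ≠ 0 := by positivity
  have hslope : (a : ℝ) / n - b / m ≠ 0 := by
    rw [sub_ne_zero, Ne, div_eq_div_iff hn' hm']
    exact_mod_cast hD
  -- Two lines of distinct slopes meet only once.
  refine mul_left_cancel₀ hslope ?_
  linear_combination -h' + h

/-- Power maps of equal slope can be made disjoint by a translation. -/
theorem exists_isLift_graphCoin_eq_empty (hn : 0 < n) (hm : 0 < m) (hD : a * m = b * n) :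
    ∃ g E, IsLift m b g E ∧ graphCoin (powerMap n a) g = ∅ := by
  -- The differences `k / n - l / m` are multiples of `1 / (n * m)`. Half of that unit is never
  -- attained: clearing denominators would equate an even and an odd integer.
  obtain ⟨g, hg⟩ := exists_isLift_affine hm b (1 / (2 * n * m))
  refine ⟨g, _, hg, Set.eq_empty_of_forall_notMem fun p hp => ?_⟩
  obtain ⟨t, k, l, h, -⟩ := ((isLift_powerMap hn a).mem_graphCoin_iff hg).1 hp
  have hn' : (n : ℝ) ≠ 0 := by positivity
  have hm' : (m : ℝ) ≠ 0 := by positivity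
  have hslope : (a : ℝ) / n = b / m := by
    rw [div_eq_div_iff hn' hm']
    exact_mod_cast hD
  rw [hslope] at h
  have h1 : (2 * (k * m) : ℝ) = 2 * (l * n) + 1 := by
    have h2 : (k : ℝ) / n = l / m + 1 / (2 * n * m) := by linarith
    field_simp at h2
    linarith
  have h3 : 2 * (k * m) = 2 * (l * n) + 1 := by exact_mod_cast h1
  omega

end Count

end NValued

/-! ### The minimum over homotopic pairs -/

theorem mainTheorem2 (n m : ℕ) (hn : 1 ≤ n) (hm : 1 ≤ m)
    (f g : UnitAddCircle → Set UnitAddCircle)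
    (hf : NValued.IsNValuedMap n f) (hg : NValued.IsNValuedMap m g)
    (a b : ℤ) (ha : NValued.degree n f = a) (hb : NValued.degree m g = b) :
    NValued.minGraphCoin n m f g = ((a * m - b * n).natAbs : ℕ∞) ∧
    NValued.PairHomotopic n m f g (NValued.powerMap n a) (NValued.powerMap m b) ∧
    (a * m ≠ b * n →
      NValued.minGraphCoin n m f g =
        (NValued.graphCoin (NValued.powerMap n a) (NValued.powerMap m b)).encard ∧
      (NValued.graphCoin (NValued.powerMap n a) (NValued.powerMap m b)).encard =
        ((a * m - b * n).natAbs : ℕ∞)) := by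
  obtain ⟨a', F, hF⟩ := hf.exists_isLift hn
  obtain ⟨b', G, hG⟩ := hg.exists_isLift hm
  obtain rfl : a' = a := hF.degree_eq.symm.trans ha
  obtain rfl : b' = b := hG.degree_eq.symm.trans hb
  have hPa := NValued.isLift_powerMap hn a'
  have hPb := NValued.isLift_powerMap hm b'
  have hpair : NValued.PairHomotopic n m f g (NValued.powerMap n a') (NValued.powerMap m b') :=
    ⟨hF.nHomotopic hPa, hG.nHomotopic hPb⟩
  have hmin : NValued.minGraphCoin n m f g = ((a' * m - b' * n).natAbs : ℕ∞) := by
    by_cases hD : a' * m = b' * n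
    · obtain ⟨g', E, hE, hempty⟩ := NValued.exists_isLift_graphCoin_eq_empty hn hm hD
      rw [sub_eq_zero.2 hD, Int.natAbs_zero, Nat.cast_zero, ← nonpos_iff_eq_zero]
      exact sInf_le ⟨_, g', hPa.isNValuedMap, hE.isNValuedMap, ⟨hpair.1, hG.nHomotopic hE⟩,
        by rw [hempty, Set.encard_empty]⟩
    · refine le_antisymm ?_ (le_sInf ?_)
      · exact sInf_le ⟨_, _, hPa.isNValuedMap, hPb.isNValuedMap, hpair,
          (NValued.encard_graphCoin_powerMap hn hm hD).symm⟩
      · rintro _ ⟨f', g', -, -, ⟨hff', hgg'⟩, rfl⟩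
        obtain ⟨F', hF'⟩ := hff'.exists_isLift hF
        obtain ⟨G', hG'⟩ := hgg'.exists_isLift hG
        exact hF'.natAbs_le_encard_graphCoin hG' hD
  exact ⟨hmin, hpair, fun hD =>
    ⟨hmin.trans (NValued.encard_graphCoin_powerMap hn hm hD).symm,
      NValued.encard_graphCoin_powerMap hn hm hD⟩⟩
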